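/- Let $G$ be a Lie group acting smoothly on the left, freely and properly, on a smooth manifold $Q$, and let $\pi:Q\to Q/G$ be the resulting smooth principal $G$-bundle, where $Q/G$ carries the quotient manifold structure (the one for which $\pi$ is a submersion). Let $\gamma:Q\to G$ be a level function, that is, a smooth map with $\gamma(g\cdot q)=g\,\gamma(q)\,g^{-1}$ for all $g\in G$, $q\in Q$, and put $\widetilde\gamma(q):=\gamma(q)\cdot q$. An affine discrete connection $\mathcal A_d$ on $\pi$ with level $\gamma$ is an embedded submanifold $\mathrm{Hor}\subseteq Q\times Q$ that contains the graph $\{(q,\widetilde\gamma(q)) : q\in Q\}$, is invariant under the diagonal action of $G$ on $Q\times Q$, and is such that $(\mathrm{id}_Q\times\pi)|_{\mathrm{Hor}}:\mathrm{Hor}\to Q\times(Q/G)$ is an injective local diffeomorphism. Its domain is $\mathfrak U:=\{(q_0,g\cdot q_1) : (q_0,q_1)\in\mathrm{Hor},\ g\in G\}$. Put $\mathfrak U':=(\mathrm{id}_Q\times\pi)(\mathrm{Hor})$, an open subset of $Q\times(Q/G)$. The affine discrete horizontal lift $h_d:\mathfrak U'\to Q\times Q$ is the inverse of the bijection $\mathrm{Hor}\to\mathfrak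 U'$ induced by $\mathrm{id}_Q\times\pi$; write $h_d^{q}(\tau):=h_d(q,\tau)$. **Theorem.** Let $\mathcal A_d$ be an affine discrete connection on $\pi$ with level $\gamma$. Then: 1. $\mathfrak U'\subseteq Q\times(Q/G)$ is $G$-invariant for the action $g\cdot(q,\tau):=(g\cdot q,\tau)$. 2. $h_d:\mathfrak U'\to Q\times Q$ is smooth and $G$-equivariant for this action and the diagonal action on $Q\times Q$. 3. $h_d$ is a section of $\mathrm{id}_Q\times\pi$ over $\mathfrak U'$, that is, $(\mathrm{id}_Q\times\pi)\circ h_d=\mathrm{id}_{\mathfrak U'}$. 4. For every $q\in Q$, $(q,\pi(q))\in\mathfrak U'$ and $h_d^{q}(\pi(q))=(q,\widetilde\gamma(q))$. Conversely, let $\mathcal U'\subseteq Q\times(Q/G)$ be an open set and $h:\mathcal U'\to Q\times Q$ a map such that conditions 1–4 hold with $\mathcal U'$, $h$ in place of $\mathfrak U'$, $h_d$. Then there is a unique affine discrete connection $\mathcal A_d$ on $\pi$ with level $\gamma$ and domain $\mathfrak U=(\mathrm{id}_Q\times\pi)^{-1}(\mathcal U')$ such that $\mathfrak U'=\mathcal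 U'$ and $h_d=h$. -/

import Mathlib

open scoped Manifold ContDiff
open TopologicalSpace

/-- A structure of embedded submanifold on a subset `S` of a smooth manifold `M`: a smooth
atlas on `S`, for the subspace topology, such that the inclusion `S → M` is a smooth embedding.
(When it exists, such a smooth structure on `S` is unique.) -/
structure EmbeddedSubmanifold {E H M : Type*} [NormedAddCommGroup E] [NormedSpace ℝ E]
    [TopologicalSpace H] (I : ModelWithCorners ℝ E H) [TopologicalSpace M] [ChartedSpace H M]
    (S : Set M) where
  dim : ℕ
  [chartedSpace : ChartedSpace (EuclideanSpace ℝ (Fin dim)) S]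
  [isManifold : IsManifold (𝓡 dim) ∞ S]
  isSmoothEmbedding : Manifold.IsSmoothEmbedding (𝓡 dim) I ∞ (Subtype.val : S → M)

attribute [instance] EmbeddedSubmanifold.chartedSpace EmbeddedSubmanifold.isManifold

/-- The orbit projection `π : Q → Q/G`. -/
def orbitProj (G : Type*) {Q : Type*} [Group G] [MulAction G Q] (q : Q) :
    MulAction.orbitRel.Quotient G Q :=
  Quotient.mk _ q

/-- The map `id × π : Q × Q → Q × (Q/G)`. -/
def idProdProj (G : Type*) {Q : Type*} [Group G] [MulAction G Q] :
    Q × Q → Q × MulAction.orbitRel.Quotient G Q :=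
  Prod.map id (orbitProj G)

/-- Level functions: smooth maps `γ : Q → G` that are equivariant, where `G` acts on itself by
conjugation. -/
structure IsLevelFunction (EQ EG : Type*) {Q G : Type*}
    [NormedAddCommGroup EQ] [NormedSpace ℝ EQ] [NormedAddCommGroup EG] [NormedSpace ℝ EG]
    [TopologicalSpace Q] [ChartedSpace EQ Q] [TopologicalSpace G] [ChartedSpace EG G]
    [Group G] [MulAction G Q] (γ : Q → G) : Prop where
  contMDiff : ContMDiff 𝓘(ℝ, EQ) 𝓘(ℝ, EG) ∞ γ
  map_smul : ∀ (g : G) (q : Q), γ (g • q) = g * γ q * g⁻¹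

/-- The map `γ̃ : Q → Q`, `γ̃ q = γ q • q`. -/
def levelMap {Q G : Type*} [Group G] [MulAction G Q] (γ : Q → G) (q : Q) : Q :=
  γ q • q

/-- An affine discrete connection with level `γ` on `π : Q → Q/G`: a subset `Hor` of `Q × Q` that
contains the graph of `γ̃`, is invariant for the diagonal action, is an embedded submanifold, and
on which `id × π` restricts to an injective local diffeomorphism `Hor → Q × (Q/G)`. -/
@[ext]
structure AffineDiscreteConnection (EQ EB : Type*) {Q G : Type*}
    [NormedAddCommGroup EQ] [NormedSpace ℝ EQ] [NormedAddCommGroup EB] [NormedSpace ℝ EB]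
    [TopologicalSpace Q] [ChartedSpace EQ Q] [Group G] [MulAction G Q]
    [ChartedSpace EB (MulAction.orbitRel.Quotient G Q)] (γ : Q → G) where
  Hor : Set (Q × Q)
  graph_mem : ∀ q : Q, (q, levelMap γ q) ∈ Hor
  smul_mem : ∀ (g : G) (p : Q × Q), p ∈ Hor → (g • p.1, g • p.2) ∈ Hor
  isLocalDiffeomorph : ∃ σ : EmbeddedSubmanifold (𝓘(ℝ, EQ).prod 𝓘(ℝ, EQ)) Hor,
    IsLocalDiffeomorph (𝓡 σ.dim) (𝓘(ℝ, EQ).prod 𝓘(ℝ, EB)) ∞ (Hor.domRestrict (idProdProj G))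
  injOn : Set.InjOn (idProdProj G) Hor

namespace AffineDiscreteConnection

variable {EQ EB Q G : Type*}
    [NormedAddCommGroup EQ] [NormedSpace ℝ EQ] [NormedAddCommGroup EB] [NormedSpace ℝ EB]
    [TopologicalSpace Q] [ChartedSpace EQ Q] [Group G] [MulAction G Q]
    [ChartedSpace EB (MulAction.orbitRel.Quotient G Q)] {γ : Q → G}

/-- The domain `𝔘 ⊆ Q × Q` of an affine discrete connection: the saturation of `Hor` under the
action of `G` on the second factor. -/
def domain (A : AffineDiscreteConnection EQ EB γ) : Set (Q × Q) :=
  {p | ∃ (g : G) (r : Q × Q), r ∈ A.Hor ∧ p = (r.1, g • r.2)}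

theorem isOpen_image (A : AffineDiscreteConnection EQ EB γ) :
    IsOpen (idProdProj G '' A.Hor) := by
  obtain ⟨σ, h⟩ := A.isLocalDiffeomorph
  rw [← Set.range_domRestrict]
  exact h.isOpen_range

/-- The open set `𝔘' = (id × π)(Hor) ⊆ Q × (Q/G)`. -/
def liftDomain (A : AffineDiscreteConnection EQ EB γ) :
    Opens (Q × MulAction.orbitRel.Quotient G Q) :=
  ⟨idProdProj G '' A.Hor, A.isOpen_image⟩

/-- The affine discrete horizontal lift `h_d : 𝔘' → Q × Q`, the inverse of the bijection
`Hor → 𝔘'` that `id × π` induces. -/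
noncomputable def horizontalLift (A : AffineDiscreteConnection EQ EB γ) :
    A.liftDomain → Q × Q :=
  fun x => ((Equiv.Set.imageOfInjOn (idProdProj G) A.Hor A.injOn).symm x : A.Hor)

end AffineDiscreteConnection

/-- The four properties of a map `h : U → Q × Q` on an open set `U ⊆ Q × (Q/G)`: `U` is
`G`-invariant, `h` is smooth and `G`-equivariant, `h` is a section of `id × π` over `U`, and
`h (q, π q) = (q, γ̃ q)`, where `G` acts on `Q × (Q/G)` through the first factor and
on `Q × Q` diagonally. -/
structure HasHorizontalLiftProperties (EQ EB : Type*) {Q G : Type*}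
    [NormedAddCommGroup EQ] [NormedSpace ℝ EQ] [NormedAddCommGroup EB] [NormedSpace ℝ EB]
    [TopologicalSpace Q] [ChartedSpace EQ Q] [Group G] [MulAction G Q]
    [ChartedSpace EB (MulAction.orbitRel.Quotient G Q)] (γ : Q → G)
    (U : Opens (Q × MulAction.orbitRel.Quotient G Q)) (h : U → Q × Q) : Prop where
  smul_mem : ∀ (g : G) (x : Q × MulAction.orbitRel.Quotient G Q), x ∈ U → (g • x.1, x.2) ∈ U
  contMDiff : ContMDiff (𝓘(ℝ, EQ).prod 𝓘(ℝ, EB)) (𝓘(ℝ, EQ).prod 𝓘(ℝ, EQ)) ∞ h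
  map_smul : ∀ (g : G) (x : U),
    h ⟨(g • x.1.1, x.1.2), smul_mem g x.1 x.2⟩ = (g • (h x).1, g • (h x).2)
  idProdProj_apply : ∀ x : U, idProdProj G (h x) = x
  map_level : ∀ q : Q, ∃ hq : (q, orbitProj G q) ∈ U,
    h ⟨(q, orbitProj G q), hq⟩ = (q, levelMap γ q)

/-!
An affine discrete connection and its horizontal lift determine each other because the horizontal
submanifold is the image of the lift.

Forward direction: `id × π` is injective on `Hor`, so a point of `Hor` is recognised as a value of
the lift from its image alone (`AffineDiscreteConnection.horizontalLift_eq`). The invariance of `𝔘'`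
and the algebraic properties of the lift follow from this. Smoothness does as well: near a point of
`𝔘'`, the lift is the inclusion of `Hor` after a local inverse of the local diffeomorphism
`Hor → Q × (Q/G)`.

Converse: take `Hor := h(U)`. All that needs an argument is that `h(U)` is an embedded submanifold,
and this holds for the image of any smooth local section `s : U → N` of a submersion `p : N → B`
(`Manifold.IsSubmersion.exists_embeddedSubmanifold_image`), here applied to `p = id × π`. Since `p`
inverts `s`, it embeds `s(U)` openly in `B`, and `s(U)` inherits a smooth structure from `B`
(`Topology.IsOpenEmbedding.exists_isManifold_isLocalDiffeomorph`). For that structure `p` restricts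
to a local diffeomorphism, and the inclusion `s(U) → N`, which is `s ∘ p`, is smooth. To see that it
is an immersion, choose charts in which `p` is the projection `(u, w) ↦ u`. In them the inclusion
reads `u ↦ (u, v u)`, and the shear `(u, w) ↦ (u, w - v u)` turns it into `u ↦ (u, 0)`
(`Manifold.IsSubmersionAtOfComplement.isImmersionAtOfComplement_of_comp`). No inverse function
theorem is needed, because the normal form of `p` is part of the definition of a submersion.
-/

open Set Topology Manifold

/-! ### Partial diffeomorphisms and charts -/

section PartialDiffeomorph

variable {𝕜 : Type*} [NontriviallyNormedField 𝕜]
  {E : Type*} [NormedAddCommGroup E] [NormedSpace 𝕜 E]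
  {F : Type*} [NormedAddCommGroup F] [NormedSpace 𝕜 F]
  {H : Type*} [TopologicalSpace H] {I : ModelWithCorners 𝕜 E H}
  {H' : Type*} [TopologicalSpace H'] {J : ModelWithCorners 𝕜 F H'}
  {M : Type*} [TopologicalSpace M] [ChartedSpace H M]
  {N : Type*} [TopologicalSpace N] [ChartedSpace H' N] {n : ℕ∞ω}

lemma ModelWithCorners.contMDiff_symm (I : ModelWithCorners 𝕜 E H) [I.Boundaryless] :
    ContMDiff 𝓘(𝕜, E) I n I.symm := by
  rw [← contMDiffOn_univ, ← I.range_eq_univ]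
  exact I.contMDiffOn_symm

namespace PartialDiffeomorph

/-- A continuous linear equivalence, as a partial diffeomorphism defined everywhere. -/
def ofLinear (e : E ≃L[𝕜] F) : PartialDiffeomorph 𝓘(𝕜, E) 𝓘(𝕜, F) E F n where
  toPartialEquiv := e.toEquiv.toPartialEquiv
  open_source := isOpen_univ
  open_target := isOpen_univ
  contMDiffOn_toFun := e.contDiff.contMDiff.contMDiffOn
  contMDiffOn_invFun := e.symm.contDiff.contMDiff.contMDiffOn

/-- The restriction of a partial diffeomorphism to an open subset of the source. -/
noncomputable def restrOpen (Φ : PartialDiffeomorph I J M N n) (s : Set M) (hs : IsOpen s) :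
    PartialDiffeomorph I J M N n where
  toPartialEquiv := Φ.toPartialEquiv.restr s
  open_source := Φ.open_source.inter hs
  open_target := Φ.toOpenPartialHomeomorph.isOpen_inter_preimage_symm hs
  contMDiffOn_toFun := Φ.contMDiffOn_toFun.mono inter_subset_left
  contMDiffOn_invFun := Φ.contMDiffOn_invFun.mono inter_subset_left

/-- On a manifold without boundary, a chart extended to the model vector space is a partial
diffeomorphism. -/
noncomputable def ofChart [I.Boundaryless] (c : OpenPartialHomeomorph M H)
    (hc : c ∈ IsManifold.maximalAtlas I n M) : PartialDiffeomorph I 𝓘(𝕜, E) M E n where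
  toPartialEquiv := c.extend I
  open_source := by simpa using c.open_source
  open_target := c.isOpen_extend_target
  contMDiffOn_toFun := by
    rw [OpenPartialHomeomorph.extend_source]
    exact c.contMDiffOn_extend hc
  contMDiffOn_invFun := by
    rw [OpenPartialHomeomorph.extend_target']
    exact contMDiffOn_extend_symm hc

/-- A partial diffeomorphism to the model vector space, read as a chart. -/
noncomputable def toChart [I.Boundaryless] (Φ : PartialDiffeomorph I 𝓘(𝕜, E) M E n) :
    OpenPartialHomeomorph M H :=
  Φ.toOpenPartialHomeomorph.trans I.toHomeomorph.symm.toOpenPartialHomeomorph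

lemma toChart_source [I.Boundaryless] (Φ : PartialDiffeomorph I 𝓘(𝕜, E) M E n) :
    Φ.toChart.source = Φ.source := by
  simp [toChart]

lemma extend_toChart [I.Boundaryless] (Φ : PartialDiffeomorph I 𝓘(𝕜, E) M E n) :
    Φ.toChart.extend I = Φ.toPartialEquiv := by
  have hI (u : E) : I (I.symm u) = u := I.right_inv (by simp [I.range_eq_univ])
  refine PartialEquiv.ext (fun x ↦ ?_) (fun u ↦ ?_) ?_
  · simp [toChart, hI]
  · simp [toChart, hI]
  · simp [toChart]

lemma toChart_mem_maximalAtlas [I.Boundaryless] [IsManifold I n M]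
    (Φ : PartialDiffeomorph I 𝓘(𝕜, E) M E n) :
    Φ.toChart ∈ IsManifold.maximalAtlas I n M := by
  refine OpenPartialHomeomorph.mem_maximalAtlas_of_contMDiffOn _ ?_ ?_
  · rw [toChart_source]
    exact I.contMDiff_symm.comp_contMDiffOn Φ.contMDiffOn_toFun
  · refine Φ.contMDiffOn_invFun.comp I.contMDiff.contMDiffOn fun y hy ↦ ?_
    simpa [toChart] using hy

/-- The shear `(x, y) ↦ (x, y - v x)` along a smooth map `v` defined on an open set `D`, as a
partial diffeomorphism of `E × F`. -/
def shear (D : Set E) (hD : IsOpen D) (v : E → F) (hv : ContDiffOn 𝕜 n v D) :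
    PartialDiffeomorph 𝓘(𝕜, E × F) 𝓘(𝕜, E × F) (E × F) (E × F) n where
  toFun z := (z.1, z.2 - v z.1)
  invFun z := (z.1, z.2 + v z.1)
  source := D ×ˢ univ
  target := D ×ˢ univ
  map_source' z hz := by simpa using hz
  map_target' z hz := by simpa using hz
  left_inv' z _ := by simp
  right_inv' z _ := by simp
  open_source := hD.prod isOpen_univ
  open_target := hD.prod isOpen_univ
  contMDiffOn_toFun := ContDiffOn.contMDiffOn <| contDiffOn_fst.prodMk <|
    contDiffOn_snd.sub <| hv.comp contDiffOn_fst fun _ hz ↦ hz.1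
  contMDiffOn_invFun := ContDiffOn.contMDiffOn <| contDiffOn_fst.prodMk <|
    contDiffOn_snd.add <| hv.comp contDiffOn_fst fun _ hz ↦ hz.1

end PartialDiffeomorph

end PartialDiffeomorph

/-! ### Right inverses of submersions are immersions -/

section Immersion

variable {𝕜 : Type*} [NontriviallyNormedField 𝕜]
  {E : Type*} [NormedAddCommGroup E] [NormedSpace 𝕜 E]
  {E' : Type*} [NormedAddCommGroup E'] [NormedSpace 𝕜 E']
  {E'' : Type*} [NormedAddCommGroup E''] [NormedSpace 𝕜 E'']
  {F : Type*} [NormedAddCommGroup F] [NormedSpace 𝕜 F]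
  {H : Type*} [TopologicalSpace H] {I : ModelWithCorners 𝕜 E H} [I.Boundaryless]
  {H' : Type*} [TopologicalSpace H'] {J : ModelWithCorners 𝕜 E' H'} [J.Boundaryless]
  {H'' : Type*} [TopologicalSpace H''] {K : ModelWithCorners 𝕜 E'' H''} [K.Boundaryless]
  {M : Type*} [TopologicalSpace M] [ChartedSpace H M]
  {N : Type*} [TopologicalSpace N] [ChartedSpace H' N]
  {B : Type*} [TopologicalSpace B] [ChartedSpace H'' B] {n : ℕ∞ω}

/-- If `p` is a submersion and `p ∘ f` is a local diffeomorphism, then `f` is an immersion, with the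
same complement as `p`. In charts, `p` is `(u, w) ↦ u` and `f` is `u ↦ (u, v u)`, and a shear of the
codomain turns `f` into `u ↦ (u, 0)`. -/
theorem Manifold.IsSubmersionAtOfComplement.isImmersionAtOfComplement_of_comp
    [IsManifold I n M] [IsManifold J n N]
    {p : N → B} {f : M → N} {x : M} (hp : IsSubmersionAtOfComplement F J K n p (f x))
    (hf : ContMDiff I J n f) (hpf : IsLocalDiffeomorphAt I K n (p ∘ f) x)
    (L : E ≃L[𝕜] E'') :
    IsImmersionAtOfComplement F I J n f x := by
  obtain ⟨Φ₀, hx, hΦ₀⟩ := hpf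
  let ψ := PartialDiffeomorph.ofChart hp.codChart hp.codChart_mem_maximalAtlas
  let χ := PartialDiffeomorph.ofChart hp.domChart hp.domChart_mem_maximalAtlas
  have hχ : χ.source = hp.domChart.source := by simp [χ, PartialDiffeomorph.ofChart]
  have hψ : ψ.source = hp.codChart.source := by simp [ψ, PartialDiffeomorph.ofChart]
  have hW : IsOpen (f ⁻¹' χ.source) := χ.open_source.preimage hf.continuous
  -- The chart of `M` near `x` in which `p ∘ f`, read in the chart `ψ` of `B`, is `L`.
  let Φ : PartialDiffeomorph I 𝓘(𝕜, E) M E n := ((Φ₀.restrOpen _ hW).trans ψ).trans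
    (.ofLinear L.symm)
  have hxχ : f x ∈ χ.source := hχ ▸ hp.mem_domChart_source
  have hΦsource {m : M} (hm : m ∈ Φ.source) : m ∈ Φ₀.source ∧ f m ∈ χ.source := hm.1.1
  have hΦ {m : M} (hm : m ∈ Φ.source) : Φ m = L.symm (ψ (p (f m))) :=
    congrArg (fun b ↦ L.symm (ψ b)) (hΦ₀ (hΦsource hm).1).symm
  have hxΦ : x ∈ Φ.source := by
    refine ⟨⟨⟨hx, hxχ⟩, ?_⟩, mem_univ _⟩
    change Φ₀ x ∈ ψ.source
    rw [← hΦ₀ hx, hψ]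
    exact hp.mem_codChart_source
  let e : (E × F) ≃L[𝕜] E' := (L.prodCongr (.refl 𝕜 F)).trans hp.equiv.symm
  have he {y : N} (hy : y ∈ χ.source) : (e.symm (χ y)).1 = L.symm (ψ (p y)) := by
    have h := hp.writtenInCharts (χ.map_source hy)
    have h' : χ.invFun (χ y) = y := χ.left_inv hy
    change ψ (p (χ.invFun (χ y))) = (hp.equiv (χ y)).1 at h
    rw [h'] at h
    exact congrArg L.symm h.symm
  -- In the charts `Φ` and `e.symm ∘ χ`, the map `f` is `u ↦ (u, v u)`.
  let v : E → F := fun u ↦ (e.symm (χ (f (Φ.invFun u)))).2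
  have hv : ContDiffOn 𝕜 n v Φ.target := by
    rw [← contMDiffOn_iff_contDiffOn]
    have h₁ : ContMDiffOn 𝓘(𝕜, E) 𝓘(𝕜, E') n (fun u ↦ χ (f (Φ.invFun u))) Φ.target :=
      χ.contMDiffOn_toFun.comp (hf.comp_contMDiffOn Φ.contMDiffOn_invFun)
        fun u hu ↦ (hΦsource (Φ.map_target hu)).2
    exact (contDiff_snd.comp e.symm.contDiff).contMDiff.comp_contMDiffOn h₁
  let Ψ : PartialDiffeomorph J 𝓘(𝕜, E') N E' n :=
    ((χ.trans (.ofLinear e.symm)).trans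
      (PartialDiffeomorph.shear Φ.target Φ.open_target v hv)).trans
      (.ofLinear e)
  refine .mk_of_continuousAt hf.continuous.continuousAt e Φ.toChart Ψ.toChart
    (Φ.toChart_source ▸ hxΦ) ?_ Φ.toChart_mem_maximalAtlas Ψ.toChart_mem_maximalAtlas ?_
  · rw [Ψ.toChart_source]
    refine ⟨⟨⟨hxχ, mem_univ _⟩, ?_, mem_univ _⟩, mem_univ _⟩
    change (e.symm (χ (f x))).1 ∈ Φ.target
    rw [he hxχ, ← hΦ hxΦ]
    exact Φ.map_source hxΦ
  · intro u hu
    rw [Φ.extend_toChart] at hu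
    rw [Φ.extend_toChart, Ψ.extend_toChart]
    have hm : Φ.invFun u ∈ Φ.source := Φ.map_target hu
    have hu' : (e.symm (χ (f (Φ.invFun u)))).1 = u := by
      rw [he (hΦsource hm).2, ← hΦ hm]
      exact Φ.right_inv hu
    change e ((e.symm (χ (f (Φ.invFun u)))).1, (e.symm (χ (f (Φ.invFun u)))).2 -
      v (e.symm (χ (f (Φ.invFun u)))).1) = e (u, 0)
    rw [hu', sub_self]

end Immersion

/-! ### Manifold structure pulled back along an open embedding -/

section OpenEmbedding

variable {𝕜 : Type*} [NontriviallyNormedField 𝕜]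
  {E : Type*} [NormedAddCommGroup E] [NormedSpace 𝕜 E]
  {E' : Type*} [NormedAddCommGroup E'] [NormedSpace 𝕜 E']
  {H : Type*} [TopologicalSpace H] {I : ModelWithCorners 𝕜 E H} [I.Boundaryless]
  {M : Type*} [TopologicalSpace M] [ChartedSpace H M]
  {X : Type*} [TopologicalSpace X] {n : ℕ∞ω}

/-- The charted space structure that an open embedding `φ : X → M` pulls back from a manifold `M`
without boundary. The model vector space `E` of `M` is replaced by `E'` along a linear
equivalence. -/
noncomputable abbrev Topology.IsOpenEmbedding.pullbackChartedSpace [Nonempty X]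
    (I : ModelWithCorners 𝕜 E H) [I.Boundaryless] {φ : X → M} (hφ : IsOpenEmbedding φ)
    (L : E' ≃L[𝕜] E) : ChartedSpace E' X where
  atlas := (fun c : OpenPartialHomeomorph M H ↦ (hφ.toOpenPartialHomeomorph φ).trans
    (c.trans (I.toHomeomorph.trans L.toHomeomorph.symm).toOpenPartialHomeomorph)) '' atlas H M
  chartAt x := (hφ.toOpenPartialHomeomorph φ).trans
    ((chartAt H (φ x)).trans
      (I.toHomeomorph.trans L.toHomeomorph.symm).toOpenPartialHomeomorph)
  mem_chart_source x := by simp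
  chart_mem_atlas x := mem_image_of_mem _ (chart_mem_atlas H (φ x))

/-- A space that embeds openly into a manifold without boundary is itself a manifold, for a
structure that makes the embedding a local diffeomorphism. -/
theorem Topology.IsOpenEmbedding.exists_isManifold_isLocalDiffeomorph [IsManifold I n M]
    {φ : X → M} (hφ : IsOpenEmbedding φ) (L : E' ≃L[𝕜] E) :
    ∃ _ : ChartedSpace E' X, IsManifold 𝓘(𝕜, E') n X ∧ IsLocalDiffeomorph 𝓘(𝕜, E') I n φ := by
  cases isEmpty_or_nonempty X
  · let _ : ChartedSpace E' X := .empty E' X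
    refine ⟨inferInstance, isManifold_of_contDiffOn _ _ _ fun e e' he ↦ he.elim,
      fun x ↦ isEmptyElim x⟩
  let _ : ChartedSpace E' X := hφ.pullbackChartedSpace I L
  let Φ := hφ.toOpenPartialHomeomorph φ
  let κ : H ≃ₜ E' := I.toHomeomorph.trans L.toHomeomorph.symm
  have hκ : ContMDiff I 𝓘(𝕜, E') n κ := L.symm.contDiff.contMDiff.comp I.contMDiff
  have hκ' : ContMDiff 𝓘(𝕜, E') I n κ.symm :=
    I.contMDiff_symm.comp L.contDiff.contMDiff
  have hX : IsManifold 𝓘(𝕜, E') n X := by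
    refine isManifold_of_contDiffOn _ _ _ ?_
    rintro _ _ ⟨c, hc, rfl⟩ ⟨c', hc', rfl⟩
    have hc₁ := contMDiffOn_symm_of_mem_maximalAtlas
      (IsManifold.subset_maximalAtlas (I := I) (n := n) hc)
    have hc₂ := contMDiffOn_of_mem_maximalAtlas
      (IsManifold.subset_maximalAtlas (I := I) (n := n) hc')
    have h : ContMDiffOn 𝓘(𝕜, E') 𝓘(𝕜, E') n (fun u ↦ κ (c' (c.symm (κ.symm u))))
        (κ.symm ⁻¹' (c.target ∩ c.symm ⁻¹' c'.source)) :=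
      hκ.comp_contMDiffOn <| hc₂.comp (hc₁.comp hκ'.contMDiffOn fun u hu ↦ hu.1) fun u hu ↦ hu.2
    rw [contMDiffOn_iff_contDiffOn] at h
    have key {u : E'} (hu : u ∈ ((Φ.trans (c.trans κ.toOpenPartialHomeomorph)).symm ≫ₕ
        (Φ.trans (c'.trans κ.toOpenPartialHomeomorph))).source) :
        κ.symm u ∈ c.target ∧ φ (Φ.symm (c.symm (κ.symm u))) = c.symm (κ.symm u) ∧
          c.symm (κ.symm u) ∈ c'.source := by
      have h₁ : c.symm (κ.symm u) ∈ Φ.target := hu.1.2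
      have h₂ : φ (Φ.symm (c.symm (κ.symm u))) = c.symm (κ.symm u) := Φ.right_inv h₁
      refine ⟨hu.1.1.2, h₂, ?_⟩
      have h₃ : φ (Φ.symm (c.symm (κ.symm u))) ∈ c'.source := hu.2.2.1
      rwa [h₂] at h₃
    refine (h.mono fun u hu ↦ ?_).congr fun u hu ↦ ?_
    · exact ⟨(key hu.1).1, (key hu.1).2.2⟩
    · exact congrArg (fun b ↦ κ (c' b)) (key hu.1).2.1
  refine ⟨inferInstance, hX, fun x ↦ ⟨⟨Φ.toPartialEquiv, Φ.open_source, Φ.open_target, ?_, ?_⟩,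
    mem_univ x, fun _ _ ↦ rfl⟩⟩
  · intro x _
    let c := chartAt H (φ x)
    let e : OpenPartialHomeomorph X E' := chartAt E' x
    have h : ContMDiffOn 𝓘(𝕜, E') I n (fun y ↦ c.symm (κ.symm (e y))) e.source :=
      contMDiffOn_chart_symm.comp (hκ'.comp_contMDiffOn contMDiffOn_chart) fun y hy ↦ by
        have : κ.symm (e y) = c (φ y) := κ.symm_apply_apply _
        rw [mem_preimage, this]
        exact c.map_source hy.2.1
    refine ((h.congr fun y hy ↦ ?_).contMDiffAt
      (e.open_source.mem_nhds (mem_chart_source E' x))).contMDiffWithinAt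
    have : κ.symm (e y) = c (φ y) := κ.symm_apply_apply _
    rw [this]
    exact (c.left_inv hy.2.1).symm
  · rintro _ hb
    obtain ⟨x, -, rfl⟩ := Φ.toPartialEquiv.image_source_eq_target.ge hb
    let c := chartAt H (φ x)
    let e : OpenPartialHomeomorph X E' := chartAt E' x
    have h : ContMDiffOn I 𝓘(𝕜, E') n (fun b ↦ e.symm (κ (c b))) (c.source ∩ Φ.target) := by
      refine contMDiffOn_chart_symm.comp
        (hκ.comp_contMDiffOn (contMDiffOn_chart.mono inter_subset_left)) ?_
      rintro _ ⟨hb, hb'⟩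
      obtain ⟨y, hy, rfl⟩ := Φ.toPartialEquiv.image_source_eq_target.ge hb'
      exact e.map_source ⟨hy, hb, mem_univ _⟩
    refine ((h.congr ?_).contMDiffAt ((c.open_source.inter Φ.open_target).mem_nhds
      ⟨mem_chart_source H (φ x), hb⟩)).contMDiffWithinAt
    rintro _ ⟨hb, hb'⟩
    obtain ⟨y, hy, rfl⟩ := Φ.toPartialEquiv.image_source_eq_target.ge hb'
    exact (Φ.left_inv hy).trans (e.left_inv (x := y) ⟨hy, hb, mem_univ _⟩).symm

end OpenEmbedding

/-! ### Images of local sections of submersions -/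

section LocalSection

variable {E : Type*} [NormedAddCommGroup E] [NormedSpace ℝ E]
  {E' : Type*} [NormedAddCommGroup E'] [NormedSpace ℝ E'] [FiniteDimensional ℝ E']
  {H : Type*} [TopologicalSpace H] {I : ModelWithCorners ℝ E H} [I.Boundaryless]
  {H' : Type*} [TopologicalSpace H'] {J : ModelWithCorners ℝ E' H'} [J.Boundaryless]
  {N : Type*} [TopologicalSpace N] [ChartedSpace H N] [IsManifold I ∞ N]
  {B : Type*} [TopologicalSpace B] [ChartedSpace H' B] [IsManifold J ∞ B]

/-- The image of a smooth local section `s : U → N` of a submersion `p : N → B` is an embedded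
submanifold of `N`, and `p` restricts to a local diffeomorphism on it. -/
theorem Manifold.IsSubmersion.exists_embeddedSubmanifold_image {p : N → B}
    (hp : IsSubmersion I J ∞ p) {U : Set B} (hU : IsOpen U) {s : B → N}
    (hs : ContMDiffOn J I ∞ s U) (hps : ∀ b ∈ U, p (s b) = b) :
    ∃ σ : EmbeddedSubmanifold I (s '' U),
      IsLocalDiffeomorph (𝓡 σ.dim) J ∞ ((s '' U).domRestrict p) := by
  have hmem (y : s '' U) : p y ∈ U ∧ s (p y) = y := by
    obtain ⟨_, b, hb, rfl⟩ := y
    rw [hps b hb]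
    exact ⟨hb, rfl⟩
  let Θ : s '' U ≃ₜ U :=
    { toFun y := ⟨p y, (hmem y).1⟩
      invFun b := ⟨s b, mem_image_of_mem s b.2⟩
      left_inv y := Subtype.ext (hmem y).2
      right_inv b := Subtype.ext (hps b b.2)
      continuous_toFun := (hp.contMDiff.continuous.comp continuous_subtype_val).subtype_mk _
      continuous_invFun := hs.continuousOn.domRestrict.subtype_mk _ }
  have hφ : IsOpenEmbedding ((s '' U).domRestrict p) :=
    hU.isOpenEmbedding_subtypeVal.comp Θ.isOpenEmbedding
  let L : EuclideanSpace ℝ (Fin (Module.finrank ℝ E')) ≃L[ℝ] E' := toEuclidean.symm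
  obtain ⟨_, _, hloc⟩ :=
    hφ.exists_isManifold_isLocalDiffeomorph (I := J) (n := ∞) L
  -- The inclusion of the image is smooth because it is `s ∘ p`.
  have hval : ContMDiff (𝓡 (Module.finrank ℝ E')) I ∞ (Subtype.val : s '' U → N) :=
    (hs.comp_contMDiff hloc.contMDiff fun y ↦ (hmem y).1).congr fun y ↦ (hmem y).2.symm
  exact ⟨⟨_, ⟨IsImmersionOfComplement.isImmersion fun y ↦
    (hp.isSubmersionOfComplement_complement y).isImmersionAtOfComplement_of_comp hval (hloc y) L,
    .subtypeVal⟩⟩, hloc⟩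

end LocalSection

/-! ### The horizontal lift of an affine discrete connection -/

section OrbitProjection

variable {Q G : Type*} [Group G] [MulAction G Q]

lemma orbitProj_smul (g : G) (q : Q) : orbitProj G (g • q) = orbitProj G q :=
  Quotient.sound ⟨g, rfl⟩

lemma orbitProj_levelMap (γ : Q → G) (q : Q) :
    orbitProj G (levelMap γ q) = orbitProj G q :=
  orbitProj_smul _ _

lemma idProdProj_smul (g : G) (r : Q × Q) :
    idProdProj G (g • r.1, g • r.2) = (g • r.1, (idProdProj G r).2) :=
  Prod.ext rfl (orbitProj_smul g r.2)

end OrbitProjection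

namespace AffineDiscreteConnection

variable {EQ EB Q G : Type*}
    [NormedAddCommGroup EQ] [NormedSpace ℝ EQ] [NormedAddCommGroup EB] [NormedSpace ℝ EB]
    [TopologicalSpace Q] [ChartedSpace EQ Q] [Group G] [MulAction G Q]
    [ChartedSpace EB (MulAction.orbitRel.Quotient G Q)] {γ : Q → G}

lemma horizontalLift_mem (A : AffineDiscreteConnection EQ EB γ) (x : A.liftDomain) :
    A.horizontalLift x ∈ A.Hor :=
  ((Equiv.Set.imageOfInjOn (idProdProj G) A.Hor A.injOn).symm x).2

lemma idProdProj_horizontalLift (A : AffineDiscreteConnection EQ EB γ) (x : A.liftDomain) :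
    idProdProj G (A.horizontalLift x) = x :=
  congrArg Subtype.val
    ((Equiv.Set.imageOfInjOn (idProdProj G) A.Hor A.injOn).apply_symm_apply x)

lemma mem_liftDomain (A : AffineDiscreteConnection EQ EB γ) {r : Q × Q} (hr : r ∈ A.Hor) :
    idProdProj G r ∈ A.liftDomain :=
  mem_image_of_mem _ hr

/-- The characterization of the lift: a point of `Hor` over `x` is the lift of `x`. -/
lemma horizontalLift_eq (A : AffineDiscreteConnection EQ EB γ) {x : A.liftDomain} {r : Q × Q}
    (hr : r ∈ A.Hor) (hx : idProdProj G r = x) : A.horizontalLift x = r :=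
  A.injOn (A.horizontalLift_mem x) hr ((A.idProdProj_horizontalLift x).trans hx.symm)

lemma mem_Hor_iff (A : AffineDiscreteConnection EQ EB γ) {r : Q × Q} :
    r ∈ A.Hor ↔ ∃ x, A.horizontalLift x = r :=
  ⟨fun hr ↦ ⟨⟨_, A.mem_liftDomain hr⟩, A.horizontalLift_eq hr rfl⟩,
    fun ⟨x, hx⟩ ↦ hx ▸ A.horizontalLift_mem x⟩

theorem domain_eq_preimage (A : AffineDiscreteConnection EQ EB γ) :
    A.domain = idProdProj G ⁻¹' (A.liftDomain : Set _) := by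
  ext ⟨q₀, q₁⟩
  constructor
  · rintro ⟨g, r, hr, h⟩
    rw [h]
    exact ⟨r, hr, Prod.ext rfl (orbitProj_smul g r.2).symm⟩
  · rintro ⟨r, hr, h⟩
    obtain ⟨h₀, h₁⟩ := Prod.ext_iff.1 h
    obtain ⟨g, hg⟩ := Quotient.exact h₁.symm
    exact ⟨g, r, hr, Prod.ext h₀.symm hg.symm⟩

theorem contMDiff_horizontalLift [IsManifold 𝓘(ℝ, EQ) ∞ Q]
    (A : AffineDiscreteConnection EQ EB γ) :
    ContMDiff (𝓘(ℝ, EQ).prod 𝓘(ℝ, EB)) (𝓘(ℝ, EQ).prod 𝓘(ℝ, EQ)) ∞ A.horizontalLift := by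
  intro x
  obtain ⟨σ, hσ⟩ := A.isLocalDiffeomorph
  let r : A.Hor := ⟨A.horizontalLift x, A.horizontalLift_mem x⟩
  have hr : A.Hor.domRestrict (idProdProj G) r = x := A.idProdProj_horizontalLift x
  let Ψ := (hσ r).localInverse
  have hx : (x : Q × MulAction.orbitRel.Quotient G Q) ∈ Ψ.source :=
    hr ▸ (hσ r).localInverse_mem_source
  have h : ContMDiffAt (𝓘(ℝ, EQ).prod 𝓘(ℝ, EB)) (𝓘(ℝ, EQ).prod 𝓘(ℝ, EQ)) ∞
      (fun y ↦ (Ψ y : Q × Q)) (x : Q × MulAction.orbitRel.Quotient G Q) :=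
    σ.isSmoothEmbedding.contMDiff.contMDiffAt.comp _
      (Ψ.contMDiffOn.contMDiffAt (Ψ.open_source.mem_nhds hx))
  refine (contMDiffAt_subtype_iff.2 h).congr_of_eventuallyEq ?_
  filter_upwards [(Ψ.open_source.preimage continuous_subtype_val).mem_nhds hx] with y hy
  exact A.horizontalLift_eq (Ψ y).2 ((hσ r).localInverse_right_inv hy)

theorem hasHorizontalLiftProperties [IsManifold 𝓘(ℝ, EQ) ∞ Q]
    (A : AffineDiscreteConnection EQ EB γ) :
    HasHorizontalLiftProperties EQ EB γ A.liftDomain A.horizontalLift where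
  smul_mem := by
    rintro g _ ⟨r, hr, rfl⟩
    exact ⟨_, A.smul_mem g r hr, idProdProj_smul g r⟩
  contMDiff := A.contMDiff_horizontalLift
  map_smul g x := A.horizontalLift_eq (A.smul_mem g _ (A.horizontalLift_mem x)) <| by
    rw [idProdProj_smul, idProdProj_horizontalLift]
    exact congrArg (fun q ↦ (g • q, x.1.2)) (congrArg Prod.fst (A.idProdProj_horizontalLift x))
  idProdProj_apply := A.idProdProj_horizontalLift
  map_level q := by
    have h : idProdProj G (q, levelMap γ q) = (q, orbitProj G q) :=
      Prod.ext rfl (orbitProj_levelMap γ q)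
    exact ⟨h ▸ A.mem_liftDomain (A.graph_mem q), A.horizontalLift_eq (A.graph_mem q) h⟩

/-- A connection is determined by its horizontal lift, whose image is `Hor`. -/
theorem ext_of_horizontalLift {A A' : AffineDiscreteConnection EQ EB γ}
    (hU : A.liftDomain = A'.liftDomain)
    (h : ∀ x : A'.liftDomain, A'.horizontalLift x = A.horizontalLift ⟨x.1, hU.symm ▸ x.2⟩) :
    A = A' := by
  ext r
  rw [mem_Hor_iff, mem_Hor_iff]
  constructor
  · rintro ⟨x, rfl⟩
    exact ⟨⟨x.1, hU.le x.2⟩, h _⟩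
  · rintro ⟨x, rfl⟩
    exact ⟨_, (h x).symm⟩

end AffineDiscreteConnection

/-! ### The affine discrete connection of a horizontal lift -/

namespace HasHorizontalLiftProperties

variable {EQ EB Q G : Type*}
    [NormedAddCommGroup EQ] [NormedSpace ℝ EQ] [FiniteDimensional ℝ EQ]
    [NormedAddCommGroup EB] [NormedSpace ℝ EB] [FiniteDimensional ℝ EB]
    [TopologicalSpace Q] [ChartedSpace EQ Q] [IsManifold 𝓘(ℝ, EQ) ∞ Q] [Group G] [MulAction G Q]
    [ChartedSpace EB (MulAction.orbitRel.Quotient G Q)]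
    [IsManifold 𝓘(ℝ, EB) ∞ (MulAction.orbitRel.Quotient G Q)] {γ : Q → G}
    {U : Opens (Q × MulAction.orbitRel.Quotient G Q)} {h : U → Q × Q}

/-- The image of a map with the properties of a horizontal lift is an embedded submanifold, being
the image of a smooth local section of the submersion `id × π`. -/
theorem exists_embeddedSubmanifold_range (hh : HasHorizontalLiftProperties EQ EB γ U h)
    (hπ : IsSubmersion 𝓘(ℝ, EQ) 𝓘(ℝ, EB) ∞
      (orbitProj G : Q → MulAction.orbitRel.Quotient G Q)) :
    ∃ σ : EmbeddedSubmanifold (𝓘(ℝ, EQ).prod 𝓘(ℝ, EQ)) (range h),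
      IsLocalDiffeomorph (𝓡 σ.dim) (𝓘(ℝ, EQ).prod 𝓘(ℝ, EB)) ∞
        ((range h).domRestrict (idProdProj G)) := by
  classical
  -- The values of the extension `s` outside `U` are irrelevant.
  let s : Q × MulAction.orbitRel.Quotient G Q → Q × Q :=
    fun x ↦ if hx : x ∈ U then h ⟨x, hx⟩ else (x.1, x.1)
  have hs (x : U) : s x = h x := dif_pos x.2
  have hsU : s '' U = range h := by
    rw [image_eq_range]
    exact congrArg range (funext hs)
  have hsmooth : ContMDiffOn (𝓘(ℝ, EQ).prod 𝓘(ℝ, EB)) (𝓘(ℝ, EQ).prod 𝓘(ℝ, EQ)) ∞ s U :=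
    fun x hx ↦ (contMDiffAt_subtype_iff (x := ⟨x, hx⟩).1 <|
      (hh.contMDiff ⟨x, hx⟩).congr_of_eventuallyEq (.of_forall hs)).contMDiffWithinAt
  rw [← hsU]
  exact (IsSubmersion.id.prodMap hπ).exists_embeddedSubmanifold_image U.isOpen hsmooth
    fun x hx ↦ (congrArg (idProdProj G) (hs ⟨x, hx⟩)).trans (hh.idProdProj_apply ⟨x, hx⟩)

/-- The affine discrete connection determined by a horizontal lift, with the image of the lift as
its horizontal submanifold. -/
def connection (hh : HasHorizontalLiftProperties EQ EB γ U h)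
    (hπ : IsSubmersion 𝓘(ℝ, EQ) 𝓘(ℝ, EB) ∞
      (orbitProj G : Q → MulAction.orbitRel.Quotient G Q)) :
    AffineDiscreteConnection EQ EB γ where
  Hor := range h
  graph_mem q := by
    obtain ⟨hq, h_eq⟩ := hh.map_level q
    exact ⟨_, h_eq⟩
  smul_mem := by
    rintro g _ ⟨x, rfl⟩
    exact ⟨_, hh.map_smul g x⟩
  isLocalDiffeomorph := hh.exists_embeddedSubmanifold_range hπ
  injOn := by
    rintro _ ⟨x, rfl⟩ _ ⟨y, rfl⟩ hxy
    rw [hh.idProdProj_apply, hh.idProdProj_apply] at hxy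
    rw [Subtype.ext hxy]

lemma liftDomain_connection (hh : HasHorizontalLiftProperties EQ EB γ U h)
    (hπ : IsSubmersion 𝓘(ℝ, EQ) 𝓘(ℝ, EB) ∞
      (orbitProj G : Q → MulAction.orbitRel.Quotient G Q)) :
    (hh.connection hπ).liftDomain = U := by
  ext x
  constructor
  · rintro ⟨_, ⟨y, rfl⟩, rfl⟩
    rw [hh.idProdProj_apply]
    exact y.2
  · exact fun hx ↦ ⟨_, mem_range_self ⟨x, hx⟩, hh.idProdProj_apply _⟩

end HasHorizontalLiftProperties

/-- `G` is a Lie group acting smoothly, freely and properly on the manifold `Q`, and `Q/G` carries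
its quotient manifold structure: the one, on the quotient topological space, for which the
projection `π : Q → Q/G` is a smooth submersion. -/
theorem mainTheorem4
    {EQ EB EG Q G : Type*}
    [NormedAddCommGroup EQ] [NormedSpace ℝ EQ] [FiniteDimensional ℝ EQ]
    [NormedAddCommGroup EB] [NormedSpace ℝ EB] [FiniteDimensional ℝ EB]
    [NormedAddCommGroup EG] [NormedSpace ℝ EG] [FiniteDimensional ℝ EG]
    [TopologicalSpace Q] [ChartedSpace EQ Q] [IsManifold 𝓘(ℝ, EQ) ∞ Q]
    [TopologicalSpace G] [ChartedSpace EG G] [Group G] [LieGroup 𝓘(ℝ, EG) ∞ G]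
    [MulAction G Q] [ContMDiffSMul 𝓘(ℝ, EG) 𝓘(ℝ, EQ) ∞ G Q] [ProperSMul G Q]
    (hfree : ∀ (g : G) (q : Q), g • q = q → g = 1)
    [ChartedSpace EB (MulAction.orbitRel.Quotient G Q)]
    [IsManifold 𝓘(ℝ, EB) ∞ (MulAction.orbitRel.Quotient G Q)]
    (hπ : Manifold.IsSubmersion 𝓘(ℝ, EQ) 𝓘(ℝ, EB) ∞
      (orbitProj G : Q → MulAction.orbitRel.Quotient G Q))
    (γ : Q → G) (hγ : IsLevelFunction EQ EG γ) :
    (∀ A : AffineDiscreteConnection EQ EB γ,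
      HasHorizontalLiftProperties EQ EB γ A.liftDomain A.horizontalLift) ∧
    (∀ (U : Opens (Q × MulAction.orbitRel.Quotient G Q)) (h : U → Q × Q),
      HasHorizontalLiftProperties EQ EB γ U h →
      ∃! A : AffineDiscreteConnection EQ EB γ,
        A.domain = idProdProj G ⁻¹' (U : Set (Q × MulAction.orbitRel.Quotient G Q)) ∧
        ∃ hU : A.liftDomain = U,
          ∀ x : U, h x = A.horizontalLift ⟨x.1, hU.symm ▸ x.2⟩) := by
  refine ⟨fun A ↦ A.hasHorizontalLiftProperties, fun U h hh ↦ ?_⟩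
  have hU := hh.liftDomain_connection hπ
  have hlift (x : U) : h x = (hh.connection hπ).horizontalLift ⟨x.1, hU.symm ▸ x.2⟩ :=
    ((hh.connection hπ).horizontalLift_eq (mem_range_self x) (hh.idProdProj_apply x)).symm
  refine ⟨hh.connection hπ, ⟨?_, hU, hlift⟩, ?_⟩
  · rw [AffineDiscreteConnection.domain_eq_preimage, hU]
  · rintro A ⟨-, hAU, hA⟩
    refine AffineDiscreteConnection.ext_of_horizontalLift (hAU.trans hU.symm) fun x ↦ ?_
    exact (hlift ⟨x.1, hU.le x.2⟩).symm.trans (hA _)
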